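/- All logarithms are base $2$. For a finite set $S$ of points in the plane with pairwise distinct $x$-coordinates, listed as $p_0,p_1,\dots$ by increasing $x$-coordinate, let $S_{\mathrm{even}}=\{p_0,p_2,\dots\}$ and $S_{\mathrm{odd}}=\{p_1,p_3,\dots\}$. A set $X$ is high above a set $Y$ if every line through two points of $X$ is above every point of $Y$ and every line through two points of $Y$ is below every point of $X$. A one-point set is a Horton set of $2^0$ points; for $k\ge 1$, a set $S$ of $2^k$ points with pairwise distinct $x$-coordinates is a Horton set of $2^k$ points if $S_{\mathrm{even}}$ and $S_{\mathrm{odd}}$ are Horton sets of $2^{k-1}$ points and $S_{\mathrm{odd}}$ is high above $S_{\mathrm{even}}$. (All Horton sets of $2^k$ points have the same order type, that is, there is a bijection between any two of them that preserves the orientation of every triple of points.) A drawing of the Horton set of $2^k$ points is a set of points with integer coordinates that has the same order type as it; the drawing is isothetic if it is itself a Horton set of $2^k$ points in the above sense. The size of a drawing is the maximum of the absolute values of the coordinates of its points. **Theorem.** There is a $k_0$ such that for all $k\ge k_0$, every isothetic drawing of the Horton set of $n=2^k$ points has size at least $n^{\frac18\log n}$. -/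

import Mathlib

namespace Horton

/-- The determinant that gives the orientation of the triple `(p, q, r)` of points of the plane:
it is positive iff `r` lies to the left of the line directed from `p` to `q`, negative iff `r` lies
to its right, and zero iff the three points are collinear. -/
def cross (p q r : ℝ × ℝ) : ℝ :=
  (q.1 - p.1) * (r.2 - p.2) - (q.2 - p.2) * (r.1 - p.1)

/-- The orientation of a triple: `-1` for a left turn, `1` for a right turn, `0` if collinear. -/
noncomputable def orientation (p q r : ℝ × ℝ) : SignType :=
  -SignType.sign (cross p q r)

/-- Two finite point sets have the same order type if some bijection between them preserves the
orientation of every triple. -/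
def SameOrderType (S T : Finset (ℝ × ℝ)) : Prop :=
  ∃ e : S ≃ T, ∀ p q r : S,
    orientation (e p : ℝ × ℝ) (e q) (e r) = orientation (p : ℝ × ℝ) q r

/-- The index of `p` when the points of `S` (with distinct `x`-coordinates) are listed as
`p₀, p₁, …` by increasing `x`-coordinate: the number of points of `S` to the left of `p`. -/
noncomputable def index (S : Finset (ℝ × ℝ)) (p : ℝ × ℝ) : ℕ :=
  (S.filter fun q => q.1 < p.1).card

/-- The subset of the even-indexed points. -/
noncomputable def evenPart (S : Finset (ℝ × ℝ)) : Finset (ℝ × ℝ) :=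
  S.filter fun p => Even (index S p)

/-- The subset of the odd-indexed points. -/
noncomputable def oddPart (S : Finset (ℝ × ℝ)) : Finset (ℝ × ℝ) :=
  S.filter fun p => Odd (index S p)

/-- `r` is above the non-vertical line through `p` and `q`. -/
def AboveLine (r p q : ℝ × ℝ) : Prop :=
  p.2 + (q.2 - p.2) / (q.1 - p.1) * (r.1 - p.1) < r.2

/-- `r` is below the non-vertical line through `p` and `q`. -/
def BelowLine (r p q : ℝ × ℝ) : Prop :=
  r.2 < p.2 + (q.2 - p.2) / (q.1 - p.1) * (r.1 - p.1)

/-- `X` is high above `Y` (for point sets without two points on a vertical line): every line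
through two points of `X` is above every point of `Y`, and every line through two points of `Y`
is below every point of `X`. -/
def HighAbove (X Y : Finset (ℝ × ℝ)) : Prop :=
  (∀ p ∈ X, ∀ q ∈ X, p ≠ q → ∀ r ∈ Y, BelowLine r p q) ∧
  (∀ p ∈ Y, ∀ q ∈ Y, p ≠ q → ∀ r ∈ X, AboveLine r p q)

/-- `S` satisfies the recursive definition of the Horton set of `2 ^ k` points. -/
def IsHortonSet : ℕ → Finset (ℝ × ℝ) → Prop
  | 0, S => S.card = 1
  | k + 1, S =>
      S.card = 2 ^ (k + 1) ∧
      Set.InjOn Prod.fst (S : Set (ℝ × ℝ)) ∧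
      IsHortonSet k (evenPart S) ∧
      IsHortonSet k (oddPart S) ∧
      HighAbove (oddPart S) (evenPart S)

/-- A finite set of points with integer coordinates, seen as a set of points of the plane. -/
noncomputable def toPlane (P : Finset (ℤ × ℤ)) : Finset (ℝ × ℝ) :=
  P.image fun p => ((p.1 : ℝ), (p.2 : ℝ))

/-- A drawing of `S`: a set of points with integer coordinates and the same order type as `S`. -/
def IsDrawing (P : Finset (ℤ × ℤ)) (S : Finset (ℝ × ℝ)) : Prop :=
  SameOrderType (toPlane P) S

/-- An isothetic drawing of the Horton set of `2 ^ k` points: a drawing of it that itself satisfies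
the recursive definition. -/
def IsIsotheticDrawing (k : ℕ) (P : Finset (ℤ × ℤ)) : Prop :=
  (∃ H : Finset (ℝ × ℝ), IsHortonSet k H ∧ IsDrawing P H) ∧ IsHortonSet k (toPlane P)

/-- The size of a drawing: the maximum of the absolute values of its coordinates. -/
def size (P : Finset (ℤ × ℤ)) : ℕ :=
  P.sup fun p => max p.1.natAbs p.2.natAbs

end Horton

/-! Call the exponent of 2 in an index its level. Points of level t are high above the points whose
index is divisible by 2^(t+1). Subtracting the line through two points of level T keeps these
relations; between the two points, levels below T then have positive height and indices divisible by
2^(T+1) negative height.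

In a window well separated from both zeros, heights within one level differ by a factor of at most 5
(`Frame.height_le_five_mul`). The window contains 2^(T+11-s) gaps between consecutive multiples of
2^s, so some gap is narrower than the window by that factor. The line rising across part of it, from
a low point to a point of level t+1, is steep, and points of level t far to the right lie above it.
This forces all points of level t in the window up (`Frame.gain`). Each descent by one level thus
gains a power of 2 whose exponent grows linearly, for a total of 2^(T-2 choose 2)
(`Frame.exists_tower`).

For integer points in a box of radius N, positive heights are at least 1/(2N) and heights between
the zeros at most 2N, so this product is at most (2N)^2. A separated window exists if some block of
points is at most 4 times as wide as each neighbour. Otherwise widths fall by factors of 4 away from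
a middle block on one side, so that block alone is too wide (`exists_balanced`). -/

namespace Horton

/-! ### Listing points by abscissa -/

/-- `p` lists the points of `S` by increasing `x`-coordinate. -/
def Enumerates (p : ℕ → ℝ × ℝ) (n : ℕ) (S : Finset (ℝ × ℝ)) : Prop :=
  (∀ i j, i < j → j < n → (p i).1 < (p j).1) ∧ S = (Finset.range n).image p

theorem Enumerates.fst_lt_iff {p : ℕ → ℝ × ℝ} {n : ℕ} {S : Finset (ℝ × ℝ)}
    (h : Enumerates p n S) {i j : ℕ} (hi : i < n) (hj : j < n) :
    (p i).1 < (p j).1 ↔ i < j := by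
  refine ⟨fun hlt => ?_, fun hij => h.1 i j hij hj⟩
  by_contra hn
  rcases (not_lt.mp hn).eq_or_lt with e | e
  · subst e; exact lt_irrefl _ hlt
  · exact lt_asymm hlt (h.1 j i e hi)

theorem Enumerates.inj {p : ℕ → ℝ × ℝ} {n : ℕ} {S : Finset (ℝ × ℝ)}
    (h : Enumerates p n S) {i j : ℕ} (hi : i < n) (hj : j < n) (e : p i = p j) : i = j := by
  rcases lt_trichotomy i j with hl | hl | hl
  · exact absurd (h.1 i j hl hj) (by rw [e]; exact lt_irrefl _)
  · exact hl
  · exact absurd (h.1 j i hl hi) (by rw [e]; exact lt_irrefl _)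

theorem Enumerates.index_eq {p : ℕ → ℝ × ℝ} {n : ℕ} {S : Finset (ℝ × ℝ)}
    (h : Enumerates p n S) {i : ℕ} (hi : i < n) : index S (p i) = i := by
  have : (S.filter fun q => q.1 < (p i).1) = (Finset.range i).image p := by
    ext q
    simp only [h.2, Finset.mem_filter, Finset.mem_image, Finset.mem_range]
    constructor
    · rintro ⟨⟨j, hj, rfl⟩, hlt⟩
      exact ⟨j, (h.fst_lt_iff hj hi).1 hlt, rfl⟩
    · rintro ⟨j, hj, rfl⟩
      exact ⟨⟨j, hj.trans hi, rfl⟩, h.1 j i hj hi⟩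
  rw [index, this, Finset.card_image_of_injOn, Finset.card_range]
  intro a ha b hb e
  simp only [Finset.coe_range, Set.mem_Iio] at ha hb
  exact h.inj (ha.trans hi) (hb.trans hi) e

theorem Enumerates.mem_evenPart {p : ℕ → ℝ × ℝ} {n : ℕ} {S : Finset (ℝ × ℝ)}
    (h : Enumerates p n S) {i : ℕ} (hi : i < n) (he : Even i) : p i ∈ evenPart S := by
  rw [evenPart, Finset.mem_filter, h.index_eq hi, h.2]
  exact ⟨Finset.mem_image_of_mem _ (Finset.mem_range.2 hi), he⟩

theorem Enumerates.mem_oddPart {p : ℕ → ℝ × ℝ} {n : ℕ} {S : Finset (ℝ × ℝ)}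
    (h : Enumerates p n S) {i : ℕ} (hi : i < n) (ho : Odd i) : p i ∈ oddPart S := by
  rw [oddPart, Finset.mem_filter, h.index_eq hi, h.2]
  exact ⟨Finset.mem_image_of_mem _ (Finset.mem_range.2 hi), ho⟩

theorem Enumerates.evenPart {p : ℕ → ℝ × ℝ} {n : ℕ} {S : Finset (ℝ × ℝ)}
    (h : Enumerates p (2 * n) S) : Enumerates (fun i => p (2 * i)) n (evenPart S) := by
  refine ⟨fun i j hij hj => h.1 _ _ (by omega) (by omega), ?_⟩
  ext q
  simp only [Finset.mem_image, Finset.mem_range]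
  constructor
  · intro hq
    rw [Horton.evenPart, Finset.mem_filter] at hq
    obtain ⟨hq, he⟩ := hq
    rw [h.2, Finset.mem_image] at hq
    obtain ⟨i, hi, rfl⟩ := hq
    rw [Finset.mem_range] at hi
    rw [h.index_eq hi] at he
    obtain ⟨m, rfl⟩ := he
    exact ⟨m, by omega, by rw [two_mul]⟩
  · rintro ⟨i, hi, rfl⟩
    exact h.mem_evenPart (by omega) (even_two_mul i)

theorem exists_enumerates (S : Finset (ℝ × ℝ)) (hS : Set.InjOn Prod.fst (S : Set (ℝ × ℝ))) :
    ∃ p, Enumerates p S.card S := by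
  classical
  have hc : (S.image Prod.fst).card = S.card := Finset.card_image_of_injOn hS
  let e := (S.image Prod.fst).orderEmbOfFin hc
  have hex : ∀ i : Fin S.card, ∃ q ∈ S, q.1 = e i := fun i =>
    Finset.mem_image.1 (Finset.orderEmbOfFin_mem _ hc i)
  choose f hf hfe using hex
  refine ⟨fun i => if h : i < S.card then f ⟨i, h⟩ else 0, ?_, ?_⟩
  · intro i j hij hj
    simp only [hij.trans hj, hj, dif_pos, hfe]
    exact e.strictMono hij
  · ext q
    simp only [Finset.mem_image, Finset.mem_range]
    constructor
    · intro hq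
      have : q.1 ∈ Set.range e := by
        rw [Finset.range_orderEmbOfFin]
        exact Finset.mem_coe.2 (Finset.mem_image_of_mem _ hq)
      obtain ⟨i, hi⟩ := this
      refine ⟨i, i.2, ?_⟩
      simp only [i.2, dif_pos]
      exact hS (hf i) hq ((hfe i).trans hi)
    · rintro ⟨i, hi, rfl⟩
      simp only [hi, dif_pos]
      exact hf _

/-! ### The Horton property by levels of indices -/

/-- `u` is an odd multiple of `2 ^ t`. -/
def OddMul (t u : ℕ) : Prop := ∃ m, u = (2 * m + 1) * 2 ^ t

/-- The part of the Horton property used for the lower bound: for every `t`, the points whose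
index is an odd multiple of `2 ^ t` are high above those whose index is divisible by
`2 ^ (t + 1)`. -/
structure IsHortonSeq (k : ℕ) (x y : ℕ → ℝ) : Prop where
  lt : ∀ i j, i < j → j < 2 ^ k → x i < x j
  below : ∀ t u v l, t < k → OddMul t u → OddMul t v → 2 ^ (t + 1) ∣ l → u < v → v < 2 ^ k →
    l < 2 ^ k → y l * (x v - x u) < y u * (x v - x l) + y v * (x l - x u)
  above : ∀ t u v l, t < k → 2 ^ (t + 1) ∣ u → 2 ^ (t + 1) ∣ v → OddMul t l → u < v →
    v < 2 ^ k → l < 2 ^ k → y u * (x v - x l) + y v * (x l - x u) < y l * (x v - x u)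

theorem aboveLine_iff {p q r : ℝ × ℝ} (h : p.1 < q.1) :
    AboveLine r p q ↔ p.2 * (q.1 - r.1) + q.2 * (r.1 - p.1) < r.2 * (q.1 - p.1) := by
  have h0 : 0 < q.1 - p.1 := sub_pos.2 h
  have : p.2 + (q.2 - p.2) / (q.1 - p.1) * (r.1 - p.1)
      = (p.2 * (q.1 - r.1) + q.2 * (r.1 - p.1)) / (q.1 - p.1) := by
    field_simp; ring
  rw [AboveLine, this, div_lt_iff₀ h0]

theorem belowLine_iff {p q r : ℝ × ℝ} (h : p.1 < q.1) :
    BelowLine r p q ↔ r.2 * (q.1 - p.1) < p.2 * (q.1 - r.1) + q.2 * (r.1 - p.1) := by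
  have h0 : 0 < q.1 - p.1 := sub_pos.2 h
  have : p.2 + (q.2 - p.2) / (q.1 - p.1) * (r.1 - p.1)
      = (p.2 * (q.1 - r.1) + q.2 * (r.1 - p.1)) / (q.1 - p.1) := by
    field_simp; ring
  rw [BelowLine, this, lt_div_iff₀ h0]

theorem OddMul.half {t u : ℕ} (h : OddMul (t + 1) u) : ∃ v, u = 2 * v ∧ OddMul t v := by
  obtain ⟨m, rfl⟩ := h
  exact ⟨(2 * m + 1) * 2 ^ t, by ring, m, rfl⟩

theorem dvd_half {t u : ℕ} (h : 2 ^ (t + 1 + 1) ∣ u) : ∃ v, u = 2 * v ∧ 2 ^ (t + 1) ∣ v := by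
  obtain ⟨m, rfl⟩ := h
  exact ⟨2 ^ (t + 1) * m, by ring, Dvd.intro _ rfl⟩

theorem OddMul.odd {u : ℕ} (h : OddMul 0 u) : Odd u := by
  obtain ⟨m, rfl⟩ := h
  exact ⟨m, by ring⟩

/-- Level 0 is the relation between the odd and even parts. Passing to the even part halves indices
and lowers levels by one, so only the recursion on the even part matters. -/
theorem IsHortonSet.isHortonSeq {k : ℕ} {S : Finset (ℝ × ℝ)} (hS : IsHortonSet k S)
    {p : ℕ → ℝ × ℝ} (hp : Enumerates p (2 ^ k) S) :
    IsHortonSeq k (fun i => (p i).1) (fun i => (p i).2) := by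
  induction k generalizing S p with
  | zero =>
    exact ⟨hp.1, fun t u v l h => absurd h (by omega), fun t u v l h => absurd h (by omega)⟩
  | succ k ih =>
    obtain ⟨-, -, he, -, hab, hbe⟩ := hS
    have hp' : Enumerates p (2 * 2 ^ k) S := by rwa [pow_succ'] at hp
    have hs := ih he hp'.evenPart
    have hpow : (2 : ℕ) ^ (k + 1) = 2 * 2 ^ k := pow_succ' 2 k
    have hne : ∀ {u v : ℕ}, u < v → v < 2 ^ (k + 1) → p u ≠ p v := fun huv hv e =>
      huv.ne (hp.inj (huv.trans hv) hv e)
    have hev : ∀ {l : ℕ}, 2 ^ (0 + 1) ∣ l → Even l := fun h => even_iff_two_dvd.2 (by simpa using h)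
    refine ⟨hp.1, ?_, ?_⟩
    · rintro (_ | t) u v l ht hu hv hl huv hv' hl'
      · exact (belowLine_iff (hp.1 u v huv hv')).1 (hab _ (hp.mem_oddPart (huv.trans hv') hu.odd) _
          (hp.mem_oddPart hv' hv.odd) (hne huv hv') _ (hp.mem_evenPart hl' (hev hl)))
      · obtain ⟨u, rfl, ou⟩ := hu.half
        obtain ⟨v, rfl, ov⟩ := hv.half
        obtain ⟨l, rfl, dl⟩ := dvd_half hl
        exact hs.below t u v l (by omega) ou ov dl (by omega) (by omega) (by omega)
    · rintro (_ | t) u v l ht hu hv hl huv hv' hl'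
      · exact (aboveLine_iff (hp.1 u v huv hv')).1 (hbe _ (hp.mem_evenPart (huv.trans hv') (hev hu)) _
          (hp.mem_evenPart hv' (hev hv)) (hne huv hv') _ (hp.mem_oddPart hl' hl.odd))
      · obtain ⟨u, rfl, du⟩ := dvd_half hu
        obtain ⟨v, rfl, dv⟩ := dvd_half hv
        obtain ⟨l, rfl, ol⟩ := hl.half
        exact hs.above t u v l (by omega) du dv ol (by omega) (by omega) (by omega)

/-- Subtracting an affine function of `x` preserves the Horton property. -/
theorem IsHortonSeq.shear {k : ℕ} {x y : ℕ → ℝ} (H : IsHortonSeq k x y) (α β : ℝ) :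
    IsHortonSeq k x (fun i => y i - (α + β * x i)) := by
  refine ⟨H.lt, fun t u v l h1 h2 h3 h4 h5 h6 h7 => ?_, fun t u v l h1 h2 h3 h4 h5 h6 h7 => ?_⟩
  · have := H.below t u v l h1 h2 h3 h4 h5 h6 h7
    linear_combination this
  · have := H.above t u v l h1 h2 h3 h4 h5 h6 h7
    linear_combination this

theorem OddMul.dvd {t s q : ℕ} (h : OddMul s q) (hts : t ≤ s) : 2 ^ t ∣ q := by
  obtain ⟨m, rfl⟩ := h
  exact Dvd.dvd.mul_left (pow_dvd_pow 2 hts) _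

theorem oddMul_add {t a : ℕ} (h : 2 ^ (t + 1) ∣ a) : OddMul t (a + 2 ^ t) := by
  obtain ⟨m, rfl⟩ := h
  exact ⟨m, by ring⟩

theorem oddMul_or_dvd {t a : ℕ} (h : 2 ^ t ∣ a) : OddMul t a ∨ 2 ^ (t + 1) ∣ a := by
  obtain ⟨m, rfl⟩ := h
  rcases Nat.even_or_odd' m with ⟨c, rfl | rfl⟩
  · exact Or.inr ⟨c, by ring⟩
  · exact Or.inl ⟨c, by ring⟩

theorem exists_short_step (f : ℕ → ℝ) {n : ℕ} (hn : 0 < n) :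
    ∃ m < n, (f (m + 1) - f m) * n ≤ f n - f 0 := by
  by_contra! hc
  have h1 : ∑ m ∈ Finset.range n, (f n - f 0) < ∑ m ∈ Finset.range n, (f (m + 1) - f m) * n :=
    Finset.sum_lt_sum_of_nonempty (Finset.nonempty_range_iff.2 hn.ne')
      fun m hm => hc m (Finset.mem_range.1 hm)
  rw [← Finset.sum_mul, Finset.sum_range_sub, Finset.sum_const, Finset.card_range,
    nsmul_eq_mul, mul_comm] at h1
  exact lt_irrefl _ h1

/-! ### Heights over a separated window -/

/-- Heights of a Horton sequence above a line through two points `qL` and `qR` whose indices are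
odd multiples of `2 ^ T`, together with a window of indices `[c, d]` of width `W` that is well
separated from `qL` and from `qR`. -/
structure Frame (k T : ℕ) (x h : ℕ → ℝ) (qL c d e qR : ℕ) (W : ℝ) : Prop where
  seq : IsHortonSeq k x h
  T_lt : T < k
  oddL : OddMul T qL
  oddR : OddMul T qR
  lt_c : qL < c
  c_lt : c < d
  d_lt : d < e
  e_lt : e < qR
  R_lt : qR < 2 ^ k
  zeroL : h qL = 0
  zeroR : h qR = 0
  width : x d - x c = W
  farL : W ≤ 4 * (x c - x qL)
  farR : W ≤ 4 * (x e - x d)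

namespace Frame

variable {k T : ℕ} {x h : ℕ → ℝ} {qL c d e qR : ℕ} {W : ℝ}

theorem le_x (F : Frame k T x h qL c d e qR W) {i j : ℕ} (hij : i ≤ j) (hj : j < 2 ^ k) :
    x i ≤ x j := by
  rcases hij.eq_or_lt with rfl | hl
  · exact le_rfl
  · exact (F.seq.lt i j hl hj).le

theorem W_pos (F : Frame k T x h qL c d e qR W) : 0 < W := by
  have := F.seq.lt c d F.c_lt (by have := F.d_lt; have := F.e_lt; have := F.R_lt; omega)
  linarith [F.width]

theorem bounds (F : Frame k T x h qL c d e qR W) {r : ℕ} (h1 : c ≤ r) (h2 : r ≤ d) :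
    qL < r ∧ r < qR ∧ r < 2 ^ k ∧ x c ≤ x r ∧ x r ≤ x d ∧ x e ≤ x qR := by
  have := F.lt_c; have := F.c_lt; have := F.d_lt; have := F.e_lt; have := F.R_lt
  exact ⟨by omega, by omega, by omega, F.le_x h1 (by omega), F.le_x h2 (by omega),
    F.le_x (by omega) (by omega)⟩

theorem height_neg (F : Frame k T x h qL c d e qR W) {r : ℕ} (h1 : c ≤ r) (h2 : r ≤ d)
    (hr : 2 ^ (T + 1) ∣ r) : h r < 0 := by
  obtain ⟨b1, b2, b3, -⟩ := F.bounds h1 h2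
  have hlr := b1.trans b2
  have := F.seq.below T qL qR r F.T_lt F.oddL F.oddR hr hlr F.R_lt b3
  rw [F.zeroL, F.zeroR] at this
  have hx := F.seq.lt _ _ hlr F.R_lt
  by_contra! hc
  nlinarith

theorem height_pos (F : Frame k T x h qL c d e qR W) {t r : ℕ} (h1 : c ≤ r) (h2 : r ≤ d)
    (ht : t < T) (hr : OddMul t r) : 0 < h r := by
  obtain ⟨b1, b2, b3, -⟩ := F.bounds h1 h2
  have hlr := b1.trans b2
  have := F.seq.above t qL qR r (ht.trans F.T_lt) (F.oddL.dvd ht) (F.oddR.dvd ht) hr hlr F.R_lt b3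
  rw [F.zeroL, F.zeroR] at this
  have hx := F.seq.lt _ _ hlr F.R_lt
  by_contra! hc
  nlinarith

/-- The line through the two points passes above both zeros `qL` and `qR`. Applied to the zero on
the side of `s`, this bounds the ratio of heights by a ratio of distances to that zero, at most 1 +
4 by separation. -/
theorem height_le_five_mul (F : Frame k T x h qL c d e qR W) {t r s : ℕ} (ht : t < T)
    (hr : OddMul t r) (hs : OddMul t s) (r1 : c ≤ r) (r2 : r ≤ d) (s1 : c ≤ s) (s2 : s ≤ d) :
    h r ≤ 5 * h s := by
  obtain ⟨a1, a2, a3, a4, a5, a6⟩ := F.bounds r1 r2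
  obtain ⟨b1, b2, b3, b4, b5, -⟩ := F.bounds s1 s2
  have pr := F.height_pos r1 r2 ht hr
  have ps := F.height_pos s1 s2 ht hs
  have hW := F.W_pos
  have e1 := F.width
  have e2 := F.farL
  have e3 := F.farR
  have hk := ht.trans F.T_lt
  rcases lt_trichotomy r s with hl | hl | hl
  · have := F.seq.below t r s qR hk hr hs (F.oddR.dvd ht) hl b3 F.R_lt
    rw [F.zeroR, zero_mul] at this
    have hz : 0 < x qR - x s := by linarith
    have : h r * (x qR - x s) < 5 * h s * (x qR - x s) := by
      nlinarith [mul_le_mul_of_nonneg_left (show x qR - x r ≤ 5 * (x qR - x s) by linarith) ps.le]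
    exact (lt_of_mul_lt_mul_right this hz.le).le
  · subst hl; linarith
  · have := F.seq.below t s r qL hk hs hr (F.oddL.dvd ht) hl a3 (b1.trans b3)
    rw [F.zeroL, zero_mul] at this
    have hz : 0 < x s - x qL := by linarith
    have : h r * (x s - x qL) < 5 * h s * (x s - x qL) := by
      nlinarith [mul_le_mul_of_nonneg_left (show x r - x qL ≤ 5 * (x s - x qL) by linarith) ps.le]
    exact (lt_of_mul_lt_mul_right this hz.le).le

/-- If `h a` is nonnegative, the line through `a` and the zero on the side away from `b` does not
descend towards `b`, and `b` lies above it. -/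
theorem height_le_of_dvd (F : Frame k T x h qL c d e qR W) {t a b : ℕ} (ht : t < T)
    (ha : 2 ^ (t + 1) ∣ a) (hb : OddMul t b) (a1 : c ≤ a) (a2 : a ≤ d) (b1 : c ≤ b) (b2 : b ≤ d) :
    h a ≤ h b := by
  obtain ⟨u1, u2, u3, u4, u5, u6⟩ := F.bounds a1 a2
  obtain ⟨v1, v2, v3, v4, v5, -⟩ := F.bounds b1 b2
  have pb := F.height_pos b1 b2 ht hb
  have hk := ht.trans F.T_lt
  rcases lt_or_ge (h a) 0 with hn | hn
  · linarith
  have xa := F.seq.lt _ _ u1 u3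
  have xa' := F.seq.lt _ _ u2 F.R_lt
  rcases lt_trichotomy a b with hl | hl | hl
  · have := F.seq.above t qL a b hk (F.oddL.dvd ht) ha hb u1 u3 v3
    rw [F.zeroL, zero_mul, zero_add] at this
    have := mul_le_mul_of_nonneg_left (sub_le_sub_right (F.seq.lt _ _ hl v3).le (x qL)) hn
    exact le_of_mul_le_mul_right (by linarith) (sub_pos.2 xa)
  · rw [hl]
  · have := F.seq.above t a qR b hk ha (F.oddR.dvd ht) hb u2 F.R_lt v3
    rw [F.zeroR, zero_mul, add_zero] at this
    have := mul_le_mul_of_nonneg_left (sub_le_sub_left (F.seq.lt _ _ hl u3).le (x qR)) hn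
    exact le_of_mul_le_mul_right (by linarith) (sub_pos.2 xa')

/-- The steep line gives `hX` at least (3/4) `hb` `Y` / `δ`, separation gives `W * V` at most 24 `Y
* Z`, and 24 · 4/3 = 32. -/
theorem gain_aux {W Y Z V ha hb hX hr δ K : ℝ} (hW : 0 < W) (hY : W ≤ 4 * Y) (hZ : W ≤ 4 * Z)
    (hV : V ≤ Y + Z + W) (hV0 : 0 < V) (hδ : 0 < δ) (hδY : δ ≤ Y) (hb0 : 0 < hb)
    (hab : 4 * ha ≤ hb)
    (hK : δ * K ≤ W) (h1 : ha * (δ - Y) + hb * Y < hX * δ) (h2 : hX * Z < hr * V) :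
    K * hb ≤ 32 * hr := by
  have s1 : 3 * (hb * Y) ≤ 4 * (hX * δ) := by
    nlinarith [mul_nonneg (sub_nonneg.2 hab) (sub_nonneg.2 hδY), mul_pos hb0 hδ]
  have hY0 : 0 < Y := by linarith
  have hZ0 : 0 < Z := by linarith
  have s2 : W * V ≤ 24 * (Y * Z) := by
    nlinarith [mul_nonneg (sub_nonneg.2 hY) (sub_nonneg.2 hZ), mul_le_mul_of_nonneg_left hV hW.le]
  have s3 : 3 * (hb * Y) * Z ≤ 4 * (hr * V) * δ := by
    nlinarith [mul_le_mul_of_nonneg_right s1 hZ0.le, mul_lt_mul_of_pos_right h2 hδ]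
  have s4 : hb * (δ * K) * V ≤ 32 * (hr * δ) * V := by
    have := mul_le_mul_of_nonneg_left (mul_le_mul_of_nonneg_right hK hV0.le) hb0.le
    nlinarith [mul_le_mul_of_nonneg_left s2 hb0.le]
  have s5 := le_of_mul_le_mul_right s4 hV0
  exact le_of_mul_le_mul_right (by linarith : K * hb * δ ≤ 32 * hr * δ) hδ

/-- A short step up from `a` to `b` forces the points of the next level to be much higher. -/
theorem gain (F : Frame k T x h qL c d e qR W) {t a b X r : ℕ} {K : ℝ} (ht : t < T)
    (ha : 2 ^ (t + 1) ∣ a) (hb : 2 ^ (t + 1) ∣ b) (hr : OddMul t r) (hX : OddMul t X)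
    (hab : a < b) (a1 : c ≤ a) (b2 : b ≤ d) (r1 : c ≤ r) (r2 : r ≤ d)
    (eX : e ≤ X) (Xlt : X < 2 ^ k) (hpos : 0 < h b) (h4 : 4 * h a ≤ h b)
    (hK : (x b - x a) * K ≤ W) : K * h b ≤ 32 * h r := by
  obtain ⟨u1, u2, u3, u4, u5, u6⟩ := F.bounds a1 (hab.le.trans b2)
  obtain ⟨v1, v2, v3, v4, v5, -⟩ := F.bounds (a1.trans hab.le) b2
  obtain ⟨w1, w2, w3, w4, w5, -⟩ := F.bounds r1 r2
  have hk := ht.trans F.T_lt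
  have dX : d < X := lt_of_lt_of_le F.d_lt eX
  have xe := F.le_x eX Xlt
  have e1 := F.width
  have e2 := F.farL
  have e3 := F.farR
  have hW := F.W_pos
  -- The far point `X` is above the steep line through `a` and `b`; the line through `r` and `X` is
  -- above the zero `qL`, which carries the height of `X` back to `r`.
  have q1 := F.seq.above t a b X hk ha hb hX hab v3 Xlt
  have q2 := F.seq.below t r X qL hk hr hX (F.oddL.dvd ht) (by omega) Xlt (w1.trans w3)
  have xab := F.seq.lt a b hab v3
  rw [F.zeroL, zero_mul] at q2
  refine gain_aux (Y := x X - x a) (Z := x r - x qL) (V := x X - x qL) (hX := h X) (ha := h a)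
    (δ := x b - x a) hW ?_ ?_ ?_ ?_ ?_ ?_ hpos h4 hK ?_ ?_ <;> linarith

end Frame

/-! ### Short gaps and the tower of heights -/

/-- A window of indices `[c, d]` of length a multiple of `2 ^ s` contains a short step between
consecutive multiples of `2 ^ s`. -/
theorem exists_short_pair (x : ℕ → ℝ) (s c n : ℕ) (hn : 0 < n) (hc : 2 ^ s ∣ c) :
    ∃ a, 2 ^ s ∣ a ∧ c ≤ a ∧ a + 2 ^ s ≤ c + n * 2 ^ s ∧
      (x (a + 2 ^ s) - x a) * n ≤ x (c + n * 2 ^ s) - x c := by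
  obtain ⟨m, hm, h⟩ := exists_short_step (fun m => x (c + m * 2 ^ s)) hn
  refine ⟨c + m * 2 ^ s, Dvd.dvd.add hc (Dvd.intro_left m rfl), by omega, ?_, ?_⟩
  · have : (m + 1) * 2 ^ s ≤ n * 2 ^ s := Nat.mul_le_mul_right _ hm
    linarith [add_mul m 1 (2 ^ s)]
  · have e : c + (m + 1) * 2 ^ s = c + m * 2 ^ s + 2 ^ s := by ring
    simpa [e] using h

/-- Climbing from level `T - 1` to level `0` multiplies heights by a factor `2 ^ (Ω(T ^ 2))`. -/
theorem Frame.exists_tower {k T : ℕ} {x h : ℕ → ℝ} {qL c d e qR : ℕ} {W : ℝ}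
    (F : Frame k T x h qL c d e qR W) (hT : 2 ≤ T) (hc : 2 ^ (T + 11) ∣ c)
    (hd : d = c + 2 ^ (T + 11)) (he : 2 ^ (T + 11) ∣ e) (heT : e + 2 ^ T < 2 ^ k) :
    ∃ b₀, c ≤ b₀ ∧ b₀ ≤ d ∧ 0 < h b₀ ∧ ∀ s t, t + s + 2 = T →
      (∀ a b, 2 ^ (t + 1) ∣ a → OddMul t b → c ≤ a → a ≤ d → c ≤ b → b ≤ d → 4 * h a ≤ h b) ∧
      ∀ b, OddMul t b → c ≤ b → b ≤ d → 2 ^ s.choose 2 * h b₀ ≤ h b := by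
  have hdk : d < 2 ^ k := by have := F.d_lt; have := F.e_lt; have := F.R_lt; omega
  have hX : ∀ t, t < T → OddMul t (e + 2 ^ t) ∧ e + 2 ^ t < 2 ^ k := fun t ht =>
    ⟨oddMul_add ((pow_dvd_pow 2 (by omega)).trans he),
      lt_of_le_of_lt (Nat.add_le_add_left (Nat.pow_le_pow_right (by norm_num) ht.le) e) heT⟩
  have short : ∀ m s, m + s = T + 11 → ∃ a, 2 ^ s ∣ a ∧ c ≤ a ∧ a + 2 ^ s ≤ d ∧
      (x (a + 2 ^ s) - x a) * 2 ^ m ≤ W := by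
    intro m s hms
    obtain ⟨a, a1, a2, a3, a4⟩ := exists_short_pair x s c (2 ^ m) (by positivity)
      ((pow_dvd_pow 2 (by omega)).trans hc)
    rw [← pow_add, hms, ← hd] at a3 a4
    exact ⟨a, a1, a2, a3, by rw [← F.width]; exact_mod_cast a4⟩
  have step : ∀ a b s m : ℕ, a ≤ b → b ≤ a + 2 ^ s → a + 2 ^ s ≤ d →
      (x (a + 2 ^ s) - x a) * 2 ^ m ≤ W → (x b - x a) * 2 ^ m ≤ W := by
    intro a b s m h1 h2 h3 h4
    have := F.le_x h2 (by omega)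
    exact le_trans (mul_le_mul_of_nonneg_right (by linarith) (by positivity)) h4
  obtain ⟨T, rfl⟩ := Nat.exists_eq_add_of_le' hT
  -- The frame level is now `T + 2`, so `a₀` has negative height and the condition on the rise to
  -- `b₀` is automatic. The gain 2^10 / 32 = 32 exceeds the 4 · 5 needed to separate level `T` from
  -- everything of higher level.
  obtain ⟨a₀, p1, p2, p3, p4⟩ := short 10 (T + 2 + 1) (by ring)
  have hlt : 2 ^ (T + 1) < 2 ^ (T + 2 + 1) := Nat.pow_lt_pow_right (by norm_num) (by omega)
  have pos2 : 0 < 2 ^ (T + 1) := by positivity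
  obtain ⟨b₀, hb₀⟩ : ∃ b₀, b₀ = a₀ + 2 ^ (T + 1) := ⟨_, rfl⟩
  have ob : OddMul (T + 1) b₀ := by
    rw [hb₀]; exact oddMul_add ((pow_dvd_pow 2 (by omega)).trans p1)
  have cb : c ≤ b₀ := by omega
  have bd : b₀ ≤ d := by omega
  have b0pos := F.height_pos cb bd (by omega) ob
  refine ⟨b₀, cb, bd, b0pos, ?_⟩
  intro s
  induction s with
  | zero =>
    intro t ht
    obtain rfl : t = T := by omega
    have key : ∀ r, OddMul t r → c ≤ r → r ≤ d → 32 * h b₀ ≤ h r := by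
      intro r hr r1 r2
      have := F.gain (K := 2 ^ 10) (by omega) ((pow_dvd_pow 2 (by omega)).trans p1) (ob.dvd le_rfl)
        hr (hX t (by omega)).1 (by omega) p2 bd r1 r2 (by omega) (hX t (by omega)).2 b0pos
        (by linarith [F.height_neg p2 (by omega) p1])
        (step _ _ _ _ (by omega) (by omega) p3 p4)
      linarith
    refine ⟨fun a b ha hb a1 a2 b1 b2 => ?_, fun b hb b1 b2 => ?_⟩
    · have := key b hb b1 b2
      rcases oddMul_or_dvd ha with o | o
      · linarith [F.height_le_five_mul (by omega) o ob a1 a2 cb bd]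
      · linarith [F.height_le_of_dvd (by omega) o ob a1 a2 cb bd]
    · have := key b hb b1 b2
      simp only [Nat.choose_zero_succ, pow_zero]
      linarith
  | succ s ih =>
    intro t ht
    obtain ⟨ih1, ih2⟩ := ih (t + 1) (by omega)
    -- The gain is 2^(s+12) / 32 = 128 · 2^s: the factor 128 covers 4 · 5, and 2^s is the growth of
    -- the tower.
    obtain ⟨a, a1, a2, a3, a4⟩ := short (s + 12) (t + 1 + 1) (by omega)
    have hlt : 2 ^ (t + 1) < 2 ^ (t + 1 + 1) := Nat.pow_lt_pow_right (by norm_num) (by omega)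
    have pos3 : 0 < 2 ^ (t + 1) := by positivity
    obtain ⟨b, hb⟩ : ∃ b, b = a + 2 ^ (t + 1) := ⟨_, rfl⟩
    have o : OddMul (t + 1) b := by rw [hb]; exact oddMul_add a1
    have cb' : c ≤ b := by omega
    have bd' : b ≤ d := by omega
    have bpos := F.height_pos cb' bd' (by omega) o
    have one_le : (1 : ℝ) ≤ 2 ^ s := one_le_pow₀ (by norm_num)
    have key : ∀ r, OddMul t r → c ≤ r → r ≤ d → 128 * (2 ^ s * h b) ≤ h r := by
      intro r hr r1 r2
      have := F.gain (K := 2 ^ (s + 12)) (by omega) ((pow_dvd_pow 2 (by omega)).trans a1)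
        (o.dvd le_rfl) hr (hX t (by omega)).1 (by omega) a2 bd' r1 r2 (by omega)
        (hX t (by omega)).2 bpos (ih1 a b a1 o a2 (by omega) cb' bd')
        (step _ _ _ _ (by omega) (by omega) a3 a4)
      rw [pow_add] at this
      linarith
    have hsb : h b ≤ 2 ^ s * h b := le_mul_of_one_le_left bpos.le one_le
    refine ⟨fun a' r ha hr a1' a2' r1 r2 => ?_, fun r hr r1 r2 => ?_⟩
    · have := key r hr r1 r2
      rcases oddMul_or_dvd ha with o' | o'
      · linarith [F.height_le_five_mul (by omega) o' o a1' a2' cb' bd']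
      · linarith [ih1 a' b o' o a1' a2' cb' bd']
    · have k1 := key r hr r1 r2
      have k2 := mul_le_mul_of_nonneg_left (ih2 b o cb' bd') (show (0 : ℝ) ≤ 2 ^ s by positivity)
      have : (s + 1).choose 2 = s + s.choose 2 := by
        rw [Nat.choose_succ_succ' s 1, Nat.choose_one_right]
      rw [this, pow_add, mul_assoc]
      linarith

/-! ### Balanced blocks -/

/-- If no interior term is comparable with both neighbours, the sequence is exponentially large
in the middle. -/
theorem exists_balanced (w : ℕ → ℝ) (n : ℕ) (hw : ∀ i, i ≤ 2 * n → 1 ≤ w i)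
    (hlt : w n < 4 ^ n) :
    ∃ i, 1 ≤ i ∧ i + 1 ≤ 2 * n ∧ w i ≤ 4 * w (i - 1) ∧ w i ≤ 4 * w (i + 1) := by
  by_contra! hc
  have hn : 1 ≤ n := by
    rcases Nat.eq_zero_or_pos n with rfl | h
    · have := hw 0 le_rfl
      simp only [pow_zero] at hlt
      linarith
    · exact h
  by_cases h0 : w n ≤ 4 * w (n - 1)
  · have h1 := hc n hn (by omega) h0
    -- A drop by a factor of 4 makes the next term comparable with its predecessor, so it must drop
    -- again on the other side.
    have : ∀ j, j + 1 ≤ n → 4 ^ (j + 1) * w (n + (j + 1)) ≤ w n ∧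
        4 * w (n + (j + 1)) < w (n + j) := by
      intro j
      induction j with
      | zero => intro _; simp only [zero_add, pow_one, add_zero]; exact ⟨h1.le, h1⟩
      | succ j ih =>
        intro hj
        obtain ⟨i1, i2⟩ := ih (by omega)
        have p := hw (n + (j + 1)) (by omega)
        have h2 := hc (n + (j + 1)) (by omega) (by omega)
          (by rw [show n + (j + 1) - 1 = n + j by omega]; linarith)
        refine ⟨?_, h2⟩
        rw [pow_succ 4 (j + 1), mul_assoc]
        refine le_trans (mul_le_mul_of_nonneg_left h2.le (by positivity)) i1
    obtain ⟨m, rfl⟩ := Nat.exists_eq_add_of_le' hn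
    have h3 := (this m le_rfl).1
    have h4 := hw (m + 1 + (m + 1)) (by omega)
    have : (4 : ℝ) ^ (m + 1) * 1 ≤ 4 ^ (m + 1) * w (m + 1 + (m + 1)) := by gcongr
    linarith
  · push Not at h0
    have : ∀ j, j + 1 ≤ n → 4 ^ (j + 1) * w (n - (j + 1)) ≤ w n ∧
        4 * w (n - (j + 1)) < w (n - j) := by
      intro j
      induction j with
      | zero => intro _; simp only [zero_add, pow_one, Nat.sub_zero]; exact ⟨h0.le, h0⟩
      | succ j ih =>
        intro hj
        obtain ⟨i1, i2⟩ := ih (by omega)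
        have p := hw (n - (j + 1)) (by omega)
        have h2 : 4 * w (n - (j + 1 + 1)) < w (n - (j + 1)) := by
          by_contra! h2
          have := hc (n - (j + 1)) (by omega) (by omega)
            (by rw [show n - (j + 1) - 1 = n - (j + 1 + 1) by omega]; exact h2)
          rw [show n - (j + 1) + 1 = n - j by omega] at this
          linarith
        refine ⟨?_, h2⟩
        rw [pow_succ 4 (j + 1), mul_assoc]
        refine le_trans (mul_le_mul_of_nonneg_left h2.le (by positivity)) i1
    obtain ⟨m, rfl⟩ := Nat.exists_eq_add_of_le' hn
    have h3 := (this m le_rfl).1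
    have h4 := hw (m + 1 - (m + 1)) (by omega)
    have : (4 : ℝ) ^ (m + 1) * 1 ≤ 4 ^ (m + 1) * w (m + 1 - (m + 1)) := by gcongr
    linarith

/-! ### Integrality -/

/-- For integer points the heights above the line through `qL` and `qR` are between `1 / (2 * N)`
and `2 * N`. -/
theorem integral_height_bounds {X Y : ℕ → ℤ} {N β : ℝ} {h : ℕ → ℝ} {qL b r qR : ℕ} {E : ℝ}
    (hβ : β * (X qR - X qL) = Y qR - Y qL) (hE : 0 < E)
    (hh : ∀ i, h i = (Y i : ℝ) - ((Y qL - β * X qL) + β * X i))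
    (xL : |(X qL : ℝ)| ≤ N) (xR : |(X qR : ℝ)| ≤ N)
    (yL : |(Y qL : ℝ)| ≤ N) (yR : |(Y qR : ℝ)| ≤ N) (yr : |(Y r : ℝ)| ≤ N)
    (x1 : (X qL : ℝ) < X r) (x2 : (X r : ℝ) < X qR) (bpos : 0 < h b) (hr : E * h b ≤ h r) :
    E ≤ (2 * N) ^ 2 := by
  have dx : (0 : ℝ) < X qR - X qL := by linarith
  have mulh : ∀ i, h i * (X qR - X qL)
      = Y i * (X qR - X qL) - (Y qL * (X qR - X i) + Y qR * (X i - X qL)) := by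
    intro i
    rw [hh]
    linear_combination (-(X i : ℝ) + X qL) * hβ
  have dN : (X qR : ℝ) - X qL ≤ 2 * N := by
    have := abs_le.1 xL
    have := abs_le.1 xR
    linarith
  -- Clearing the denominator of the slope turns the height into a positive integer.
  have hlow : 1 ≤ h b * (X qR - X qL) := by
    have h0 : 0 < h b * (X qR - X qL) := mul_pos bpos dx
    rw [mulh] at h0 ⊢
    have : 0 < Y b * (X qR - X qL) - (Y qL * (X qR - X b) + Y qR * (X b - X qL)) := by
      exact_mod_cast h0
    exact_mod_cast (Int.add_one_le_iff.2 this)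
  have hup : h r ≤ 2 * N := by
    have y0 := abs_le.1 yr
    have yL := abs_le.1 yL
    have yR := abs_le.1 yR
    have : h r * (X qR - X qL) ≤ 2 * N * (X qR - X qL) := by
      rw [mulh]
      nlinarith [mul_nonneg (sub_nonneg.2 y0.2) dx.le,
        mul_nonneg (show 0 ≤ Y qL + N by linarith) (sub_pos.2 x2).le,
        mul_nonneg (show 0 ≤ Y qR + N by linarith) (sub_pos.2 x1).le]
    exact le_of_mul_le_mul_right this dx
  have c1 : E * 1 ≤ E * (h b * (X qR - X qL)) := mul_le_mul_of_nonneg_left hlow hE.le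
  have c2 := mul_le_mul_of_nonneg_right (hr.trans hup) dx.le
  have c3 := mul_le_mul_of_nonneg_left dN (show 0 ≤ 2 * N by linarith)
  linarith

/-- An integral Horton sequence in the box of radius `N` with blocks of `2 ^ (T + 11)` points: if
one block is balanced between its neighbours then `N` is large. -/
theorem IsHortonSeq.two_pow_le_of_balanced {k T : ℕ} {X Y : ℕ → ℤ} {N : ℝ}
    (H : IsHortonSeq k (fun i => (X i : ℝ)) (fun i => (Y i : ℝ)))
    (hX : ∀ i < 2 ^ k, |(X i : ℝ)| ≤ N) (hY : ∀ i < 2 ^ k, |(Y i : ℝ)| ≤ N)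
    (hT : 2 ≤ T) {j : ℕ} (hj : (j + 5) * 2 ^ (T + 11) ≤ 2 ^ k) {w : ℕ → ℝ}
    (hw : ∀ i, w i = X ((i + 1) * 2 ^ (T + 11)) - X (i * 2 ^ (T + 11)))
    (h1 : w (j + 2) ≤ 4 * w (j + 1)) (h2 : w (j + 2) ≤ 4 * w (j + 3)) :
    2 ^ (T - 2).choose 2 ≤ (2 * N) ^ 2 := by
  have P : 0 < 2 ^ T := by positivity
  have hP : 2 ^ (T + 11) = 2048 * 2 ^ T := by rw [pow_add]; ring
  -- `qL` is the last multiple of `2 ^ T` before block `j + 1`, and `qR` the first after the start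
  -- of block `j + 4`. The window is block `j + 2`, and its two neighbours provide the separation.
  obtain ⟨qL, hL⟩ : ∃ q, q = (2 * (j * 1024 + 1023) + 1) * 2 ^ T := ⟨_, rfl⟩
  obtain ⟨qR, hR⟩ : ∃ q, q = (2 * ((j + 4) * 1024) + 1) * 2 ^ T := ⟨_, rfl⟩
  have hJ : (j + 5) * 2 ^ (T + 11) = 2048 * (j * 2 ^ T) + 10240 * 2 ^ T := by rw [hP]; ring
  have hc : (j + 2) * 2 ^ (T + 11) = 2048 * (j * 2 ^ T) + 4096 * 2 ^ T := by rw [hP]; ring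
  have hb : (j + 1) * 2 ^ (T + 11) = 2048 * (j * 2 ^ T) + 2048 * 2 ^ T := by rw [hP]; ring
  have hd : (j + 3) * 2 ^ (T + 11) = 2048 * (j * 2 ^ T) + 6144 * 2 ^ T := by rw [hP]; ring
  have he : (j + 4) * 2 ^ (T + 11) = 2048 * (j * 2 ^ T) + 8192 * 2 ^ T := by rw [hP]; ring
  have hL' : qL = 2048 * (j * 2 ^ T) + 2047 * 2 ^ T := by rw [hL]; ring
  have hR' : qR = 2048 * (j * 2 ^ T) + 8193 * 2 ^ T := by rw [hR]; ring
  obtain ⟨b, eb⟩ : ∃ b, b = (j + 1) * 2 ^ (T + 11) := ⟨_, rfl⟩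
  obtain ⟨c, ec⟩ : ∃ c, c = (j + 2) * 2 ^ (T + 11) := ⟨_, rfl⟩
  obtain ⟨d, ed⟩ : ∃ d, d = (j + 3) * 2 ^ (T + 11) := ⟨_, rfl⟩
  obtain ⟨e, ee⟩ : ∃ e, e = (j + 4) * 2 ^ (T + 11) := ⟨_, rfl⟩
  have w1 := hw (j + 1)
  have w2 := hw (j + 2)
  have w3 := hw (j + 3)
  rw [show j + 1 + 1 = j + 2 by ring, ← eb, ← ec] at w1
  rw [show j + 2 + 1 = j + 3 by ring, ← ec, ← ed] at w2
  rw [show j + 3 + 1 = j + 4 by ring, ← ed, ← ee] at w3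
  rw [hJ] at hj
  rw [← eb] at hb
  rw [← ec] at hc
  rw [← ed] at hd
  rw [← ee] at he
  have dc : 2 ^ (T + 11) ∣ c := ec ▸ Dvd.intro_left _ rfl
  have de : 2 ^ (T + 11) ∣ e := ee ▸ Dvd.intro_left _ rfl
  have d2 : 2 ^ (0 + 1) ∣ c := (pow_dvd_pow 2 (by omega)).trans dc
  have hdc : d = c + 2 ^ (T + 11) := by omega
  have hTk : T < k := by
    by_contra! hc
    have := Nat.pow_le_pow_right (show 0 < 2 by norm_num) hc
    omega
  have odd_succ : OddMul 0 (c + 1) := by simpa using oddMul_add d2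
  have i1 : qL < b := by omega
  have i2 : qL < c := by omega
  have i3 : c < d := by omega
  have i4 : d < e := by omega
  have i5 : e < qR := by omega
  have i6 : qR < 2 ^ k := by omega
  have i7 : e + 2 ^ T < 2 ^ k := by omega
  have i8 : c + 1 ≤ d := i3
  have qLb : (X qL : ℝ) < X b := H.lt _ _ i1 (by omega)
  have qLR : (X qL : ℝ) < X qR := H.lt _ _ (by omega) i6
  have dx : (0 : ℝ) < X qR - X qL := sub_pos.2 qLR
  obtain ⟨β, hβ⟩ : ∃ β : ℝ, β = (Y qR - Y qL) / (X qR - X qL) := ⟨_, rfl⟩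
  have hβ' : β * (X qR - X qL) = Y qR - Y qL := by rw [hβ, div_mul_cancel₀ _ dx.ne']
  obtain ⟨h, hh⟩ : ∃ h : ℕ → ℝ, h = fun i => (Y i : ℝ) - ((Y qL - β * X qL) + β * X i) :=
    ⟨_, rfl⟩
  have hh' : ∀ i, h i = (Y i : ℝ) - ((Y qL - β * X qL) + β * X i) := fun i => by rw [hh]
  have F : Frame k T (fun i => (X i : ℝ)) h qL c d e qR (w (j + 2)) := by
    refine ⟨?_, hTk, ⟨_, hL⟩, ⟨_, hR⟩, i2, i3, i4, i5, i6, ?_, ?_, w2.symm, ?_, ?_⟩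
    · rw [hh]; exact H.shear _ _
    · rw [hh']; ring
    · rw [hh']; linear_combination -hβ'
    · linarith
    · linarith
  obtain ⟨b₀, b1, b2, bpos, htower⟩ := F.exists_tower hT dc hdc de i7
  have hr := (htower (T - 2) 0 (by omega)).2 (c + 1) odd_succ (Nat.le_succ c) i8
  have x1 : (X qL : ℝ) < X (c + 1) := H.lt _ _ (by omega) (by omega)
  have x2 : (X (c + 1) : ℝ) < X qR := H.lt _ _ (by omega) i6
  exact integral_height_bounds hβ' (by positivity) hh' (hX _ (by omega)) (hX _ i6)
    (hY _ (by omega)) (hY _ i6) (hY _ (by omega)) x1 x2 bpos hr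

/-! ### Numerical estimates and conclusion -/

/-- Serves to fit 2k² + 3 blocks when k ≤ 20(e + 1); 800 is 2 · 20². -/
theorem sq_le_two_pow {e : ℕ} (he : 20 ≤ e) : 800 * (e + 1) ^ 2 + 3 ≤ 2 ^ e := by
  induction e, he using Nat.le_induction with
  | base => norm_num
  | succ e he ih =>
    rw [pow_succ 2 e]
    nlinarith

theorem rpow_eighth_mul_logb (k : ℕ) :
    ((2 ^ k : ℕ) : ℝ) ^ ((1 / 8 : ℝ) * Real.logb 2 ((2 ^ k : ℕ) : ℝ))
      = (2 : ℝ) ^ ((k : ℝ) ^ 2 / 8) := by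
  push_cast
  rw [← Real.rpow_natCast 2 k, Real.logb_rpow (by norm_num) (by norm_num),
    ← Real.rpow_mul (by norm_num)]
  congr 1
  ring

/-- The exponents compare as 2 + k²/4 against about 0.405 k². -/
theorem two_mul_rpow_sq_le {k m : ℕ} (hk : 1000 ≤ k) (hm : 9 * k ≤ 10 * m) :
    ((2 : ℝ) * 2 ^ ((k : ℝ) ^ 2 / 8)) ^ 2 ≤ 2 ^ m.choose 2 := by
  have hkR : (1000 : ℝ) ≤ k := by exact_mod_cast hk
  have hmR : (9 : ℝ) * k ≤ 10 * m := by exact_mod_cast hm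
  have e1 : ((2 : ℝ) * 2 ^ ((k : ℝ) ^ 2 / 8)) ^ 2 = 2 ^ (2 + (k : ℝ) ^ 2 / 4) := by
    rw [Real.rpow_add (by norm_num), mul_pow, ← Real.rpow_mul_natCast (by norm_num)]
    norm_num
    ring_nf
  rw [e1, ← Real.rpow_natCast 2 (m.choose 2), Nat.cast_choose_two]
  refine Real.rpow_le_rpow_of_exponent_le (by norm_num) ?_
  nlinarith

theorem two_mul_rpow_le_four_pow {k : ℕ} (hk : 1 ≤ k) :
    (2 : ℝ) * 2 ^ ((k : ℝ) ^ 2 / 8) ≤ 4 ^ (k ^ 2) := by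
  have hkR : (1 : ℝ) ≤ k := by exact_mod_cast hk
  have e1 : (4 : ℝ) ^ (k ^ 2) = 2 ^ (2 * (k : ℝ) ^ 2) := by
    rw [Real.rpow_mul (by norm_num), ← Nat.cast_pow, Real.rpow_natCast]
    norm_num
  have e2 : (2 : ℝ) * 2 ^ ((k : ℝ) ^ 2 / 8) = 2 ^ (1 + (k : ℝ) ^ 2 / 8) := by
    rw [Real.rpow_add (by norm_num), Real.rpow_one]
  rw [e1, e2]
  refine Real.rpow_le_rpow_of_exponent_le (by norm_num) ?_
  nlinarith

theorem abs_le_size {P : Finset (ℤ × ℤ)} {p : ℤ × ℤ} (hp : p ∈ P) :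
    |(p.1 : ℝ)| ≤ size P ∧ |(p.2 : ℝ)| ≤ size P := by
  have h : max p.1.natAbs p.2.natAbs ≤ size P :=
    Finset.le_sup (f := fun p : ℤ × ℤ => max p.1.natAbs p.2.natAbs) hp
  rw [← Int.cast_abs, ← Int.cast_abs, Int.abs_eq_natAbs, Int.abs_eq_natAbs]
  exact ⟨by exact_mod_cast (le_max_left _ _).trans h, by exact_mod_cast (le_max_right _ _).trans h⟩

theorem IsHortonSet.card_eq {k : ℕ} {S : Finset (ℝ × ℝ)} (h : IsHortonSet k S) :
    S.card = 2 ^ k := by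
  cases k with
  | zero => exact h
  | succ k => exact h.1

/-- An integral Horton sequence of `2 ^ k` points needs coordinates of size `2 ^ (k ^ 2 / 8)`. -/
theorem IsHortonSeq.rpow_le {k : ℕ} (hk : 1000 ≤ k) {X Y : ℕ → ℤ} {N : ℝ} (hN : 0 ≤ N)
    (H : IsHortonSeq k (fun i => (X i : ℝ)) (fun i => (Y i : ℝ)))
    (hX : ∀ i < 2 ^ k, |(X i : ℝ)| ≤ N) (hY : ∀ i < 2 ^ k, |(Y i : ℝ)| ≤ N) :
    (2 : ℝ) ^ ((k : ℝ) ^ 2 / 8) ≤ N := by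
  -- A twentieth of the bits of an index number the blocks: enough for quadratically many in k,
  -- while `T` stays close to 19k/20.
  obtain ⟨T, hT⟩ : ∃ T, k = k / 20 + (T + 11) := ⟨k - k / 20 - 11, by omega⟩
  have hk2 : 1 ≤ k ^ 2 := Nat.one_le_pow _ _ (by omega)
  have hB : 2 * k ^ 2 + 3 ≤ 2 ^ (k / 20) := by
    have := sq_le_two_pow (e := k / 20) (by omega)
    have h1 : k ≤ 20 * (k / 20 + 1) := by omega
    nlinarith
  have hpow : 2 ^ k = 2 ^ (k / 20) * 2 ^ (T + 11) := by rw [← pow_add, ← hT]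
  have hidx : ∀ i, i < 2 ^ (k / 20) → i * 2 ^ (T + 11) < 2 ^ k := fun i hi => by
    rw [hpow]; exact Nat.mul_lt_mul_of_pos_right hi (by positivity)
  obtain ⟨w, hw⟩ : ∃ w : ℕ → ℝ,
      ∀ i, w i = X ((i + 1) * 2 ^ (T + 11)) - X (i * 2 ^ (T + 11)) := ⟨_, fun _ => rfl⟩
  have hw1 : ∀ i, i ≤ 2 * k ^ 2 → 1 ≤ w (i + 1) := by
    intro i hi
    have := H.lt ((i + 1) * 2 ^ (T + 11)) ((i + 1 + 1) * 2 ^ (T + 11))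
      (Nat.mul_lt_mul_of_pos_right (by omega) (by positivity)) (hidx _ (by omega))
    have : X ((i + 1) * 2 ^ (T + 11)) + 1 ≤ X ((i + 1 + 1) * 2 ^ (T + 11)) :=
      Int.add_one_le_iff.2 (by exact_mod_cast this)
    have : (X ((i + 1) * 2 ^ (T + 11)) : ℝ) + 1 ≤ X ((i + 1 + 1) * 2 ^ (T + 11)) := by
      exact_mod_cast this
    rw [hw]
    linarith
  by_cases hlt : w (k ^ 2 + 1) < 4 ^ (k ^ 2)
  -- The shift by one keeps a whole block to the left of the balanced triple free for `qL`.
  · obtain ⟨i, i1, i2, i3, i4⟩ := exists_balanced (fun i => w (i + 1)) (k ^ 2) hw1 hlt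
    obtain ⟨j, rfl⟩ := Nat.exists_eq_add_of_le' i1
    have key := H.two_pow_le_of_balanced hX hY (by omega) (j := j) (T := T)
      (by rw [hpow]; exact Nat.mul_le_mul_right _ (by omega)) hw i3 i4
    obtain ⟨m, rfl⟩ := Nat.exists_eq_add_of_le' (show 2 ≤ T by omega)
    rw [Nat.add_sub_cancel] at key
    have e1 := (two_mul_rpow_sq_le hk (m := m) (by omega)).trans key
    have := (sq_le_sq₀ (by positivity) (by positivity)).1 e1
    linarith
  · have h1 := abs_le.1 (hX _ (hidx (k ^ 2 + 1 + 1) (by omega)))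
    have h2 := abs_le.1 (hX _ (hidx (k ^ 2 + 1) (by omega)))
    rw [not_lt, hw] at hlt
    have h3 : (4 : ℝ) ^ (k ^ 2) ≤ 2 * N := by linarith
    have h4 := two_mul_rpow_le_four_pow (k := k) (by omega)
    linarith

theorem IsHortonSet.rpow_le_size {k : ℕ} (hk : 1000 ≤ k) {P : Finset (ℤ × ℤ)}
    (hP : IsHortonSet k (toPlane P)) : (2 : ℝ) ^ ((k : ℝ) ^ 2 / 8) ≤ size P := by
  have hinj : Set.InjOn Prod.fst (toPlane P : Set (ℝ × ℝ)) := by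
    obtain ⟨l, rfl⟩ := Nat.exists_eq_add_of_le' (show 1 ≤ k by omega)
    exact hP.2.1
  obtain ⟨p, hp⟩ := exists_enumerates (toPlane P) hinj
  rw [hP.card_eq] at hp
  have hex : ∀ i, ∃ z : ℤ × ℤ, i < 2 ^ k → z ∈ P ∧ ((z.1 : ℝ), (z.2 : ℝ)) = p i := by
    intro i
    by_cases hi : i < 2 ^ k
    · have : p i ∈ toPlane P := by
        rw [hp.2]; exact Finset.mem_image_of_mem _ (Finset.mem_range.2 hi)
      obtain ⟨z, hz, hzp⟩ := Finset.mem_image.1 this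
      exact ⟨z, fun _ => ⟨hz, hzp⟩⟩
    · exact ⟨0, fun h => absurd h hi⟩
  choose z hz using hex
  have hq : Enumerates (fun i => (((z i).1 : ℝ), ((z i).2 : ℝ))) (2 ^ k) (toPlane P) := by
    refine ⟨fun i j hij hj => ?_, ?_⟩
    · beta_reduce
      rw [(hz i (hij.trans hj)).2, (hz j hj).2]
      exact hp.1 i j hij hj
    · rw [hp.2]
      exact Finset.image_congr fun i hi => ((hz i (Finset.mem_range.1 hi)).2).symm
  exact (hP.isHortonSeq hq).rpow_le hk (X := fun i => (z i).1) (Y := fun i => (z i).2)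
    (Nat.cast_nonneg _) (fun i hi => (abs_le_size (hz i hi).1).1)
    (fun i hi => (abs_le_size (hz i hi).1).2)

end Horton

theorem theorem2 :
    ∃ k₀ : ℕ, ∀ k : ℕ, k₀ ≤ k → ∀ n : ℕ, n = 2 ^ k →
      ∀ P : Finset (ℤ × ℤ), Horton.IsIsotheticDrawing k P →
        (n : ℝ) ^ ((1 / 8 : ℝ) * Real.logb 2 (n : ℝ)) ≤ (Horton.size P : ℝ) := by
  refine ⟨1000, fun k hk n hn P hP => ?_⟩
  rw [hn, Horton.rpow_eighth_mul_logb]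
  exact hP.2.rpow_le_size hk
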